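/- A packing of $n$ unit disks in the Euclidean plane (closed disks of radius $1$ with pairwise disjoint interiors) is called totally separable if any two of its disks can be separated by a line that is disjoint from the interior of every disk of the packing. Its contact number is the number of unordered pairs of disks of the packing that touch each other. For every integer $n>1$, the maximum contact number $c(n,2)$ over all totally separable packings of $n$ unit disks in the plane is $$c(n,2)=\lfloor 2n-2\sqrt{n}\rfloor .$$ -/

import Mathlib

namespace SeparablePacking

/-- Euclidean `d`-space. -/
abbrev E (d : ℕ) : Type := EuclideanSpace ℝ (Fin d)

/-- The closed unit ball (unit disk for `d = 2`) with center `x`. -/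
def unitBall {d : ℕ} (x : E d) : Set (E d) := Metric.closedBall x 1

/-- The hyperplane with normal vector `u` (meant to be nonzero) and offset `t`. -/
def hyperplane {d : ℕ} (u : E d) (t : ℝ) : Set (E d) := {x | inner ℝ u x = t}

/-- The sets `A` and `B` lie in opposite closed half-spaces of the hyperplane `(u, t)`.
Interchanging the two sides amounts to replacing `(u, t)` by `(-u, -t)`. -/
def SeparatedBy {d : ℕ} (u : E d) (t : ℝ) (A B : Set (E d)) : Prop :=
  (∀ x ∈ A, inner ℝ u x ≤ t) ∧ (∀ x ∈ B, t ≤ inner ℝ u x)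

/-- The unit balls with centers `c i` form a packing: their interiors are pairwise disjoint. -/
def IsPacking {d n : ℕ} (c : Fin n → E d) : Prop :=
  ∀ i j, i ≠ j → Disjoint (interior (unitBall (c i))) (interior (unitBall (c j)))

/-- A packing of unit balls is totally separable if any two of its balls can be separated by a
hyperplane that is disjoint from the interior of every ball of the packing. -/
def IsTotallySeparable {d n : ℕ} (c : Fin n → E d) : Prop :=
  IsPacking c ∧
    ∀ i j, i ≠ j → ∃ (u : E d) (t : ℝ), u ≠ 0 ∧
      SeparatedBy u t (unitBall (c i)) (unitBall (c j)) ∧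
      ∀ k, Disjoint (hyperplane u t) (interior (unitBall (c k)))

/-- The contact graph: two different balls are adjacent if they touch, i.e. (the balls being
non-overlapping) if they have a common point. -/
def contactGraph {d n : ℕ} (c : Fin n → E d) : SimpleGraph (Fin n) where
  Adj i j := i ≠ j ∧ (unitBall (c i) ∩ unitBall (c j)).Nonempty
  symm := ⟨fun _ _ h => ⟨h.1.symm, by rw [Set.inter_comm]; exact h.2⟩⟩
  loopless := ⟨fun _ h => h.1 rfl⟩

/-- The number of (unordered) touching pairs. -/
noncomputable def contactNumber {d n : ℕ} (c : Fin n → E d) : ℕ :=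
  (contactGraph c).edgeSet.ncard

/-- All contact numbers of totally separable packings of `n` unit balls in `d`-space. -/
def contactNumbers (n d : ℕ) : Set ℕ :=
  {m | ∃ c : Fin n → E d, IsTotallySeparable c ∧ contactNumber c = m}

/-- `c(n, d)`: the maximum contact number of totally separable packings of `n` unit balls
in `d`-space. -/
noncomputable def maxContactNumber (n d : ℕ) : ℕ := sSup (contactNumbers n d)

end SeparablePacking

/-!
Upper bound. If two unit disks of a totally separable packing touch, the line separating them must
be their common tangent, and the other disks stay off it; hence two contacts of one disk make an
angle of at least `π / 2`. Split the nonzero vectors of the plane into two half-open quadrants and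
their negatives. By the angle bound a disk has at most one contact in each of these four, so the
contacts in the direction of either quadrant form disjoint monotone paths covering the packing. Each
path has one contact fewer than disks, so if the two systems consist of `p` and `q` paths, there are
`2n - (p + q)` contacts. A disk is determined by the two paths through it, because differences
within the two systems lie in disjoint double cones. Hence `n ≤ p q` and `p + q ≥ 2√n`.

Lower bound. Fill an orthogonal grid with `a` columns and `b` rows row by row, where
`a + b = ⌈2√n⌉` and `n ≤ a b`.
-/

namespace SeparablePacking

open Function Relation Relator
open scoped RealInnerProductSpace

section Relations

variable {V ι : Type*}

/-- The elements without a successor under the relation `r`. If `r` decomposes a finite type into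
directed paths, these are the ends of the paths, so their number counts the paths. -/
def terminals (r : V → V → Prop) : Set V := {i | ∀ j, ¬ r i j}

lemma exists_mem_terminals_reflTransGen {r : V → V → Prop} (hr : WellFounded (swap r)) (i : V) :
    ∃ z ∈ terminals r, ReflTransGen r i z := by
  obtain ⟨z, hiz, hz⟩ := hr.has_min {z | ReflTransGen r i z} ⟨i, .refl⟩
  exact ⟨z, fun j hzj => hz j (hiz.tail hzj) hzj, hiz⟩

lemma eq_or_rel_of_reflTransGen {r s : V → V → Prop} [IsTrans V s] (hrs : r ≤ s) {i j : V}
    (h : ReflTransGen r i j) : i = j ∨ s i j :=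
  (reflTransGen_iff_eq_or_transGen.1 h).imp Eq.symm (transGen_minimal hrs i j)

/-- Along a left-unique relation, elements with a common terminal lie on one path. -/
lemma exists_map_terminals [Finite V] {r s : V → V → Prop} [IsStrictOrder V s]
    (hr : LeftUnique r) (hrs : r ≤ s) :
    ∃ f : V → V, (∀ i, f i ∈ terminals r) ∧ ∀ i j, f i = f j → i = j ∨ SymmGen s i j := by
  have hwf : WellFounded (swap r) :=
    Subrelation.wf (fun h => hrs _ _ h) (Finite.wellFounded_of_trans_of_irrefl (swap s))
  choose f hf hif using exists_mem_terminals_reflTransGen hwf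
  refine ⟨f, hf, fun i j hij => ?_⟩
  have hjf : ReflTransGen r j (f i) := hij ▸ hif j
  rcases ReflTransGen.total_of_right_unique hr.flip (reflTransGen_swap.2 (hif i))
    (reflTransGen_swap.2 hjf) with h | h
  · exact (eq_or_rel_of_reflTransGen hrs (reflTransGen_swap.1 h)).imp Eq.symm Or.inr
  · exact (eq_or_rel_of_reflTransGen hrs (reflTransGen_swap.1 h)).imp id Or.inl

lemma card_le_prod_ncard_terminals [Finite V] [Fintype ι] {r s : ι → V → V → Prop}
    [∀ k, IsStrictOrder V (s k)] (hr : ∀ k, LeftUnique (r k)) (hrs : ∀ k, r k ≤ s k)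
    (hs : ∀ i j, ∃ k, ¬ SymmGen (s k) i j) :
    Nat.card V ≤ ∏ k, (terminals (r k)).ncard := by
  choose f hf hfs using fun k => exists_map_terminals (hr k) (hrs k)
  let g : V → ∀ k, terminals (r k) := fun i k => ⟨f k i, hf k i⟩
  have hg : Injective g := fun i j hij => by
    obtain ⟨k, hk⟩ := hs i j
    exact (hfs k i j (congrArg Subtype.val (congrFun hij k))).resolve_right hk
  simpa only [Nat.card_pi, Nat.card_coe_set_eq] using Nat.card_le_card_of_injective g hg

lemma ncard_edgeSet_fromRel_add_ncard_terminals [Finite V] {r : V → V → Prop}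
    (hr : RightUnique r) (hasymm : ∀ ⦃i j⦄, r i j → ¬ r j i) :
    (SimpleGraph.fromRel r).edgeSet.ncard + (terminals r).ncard = Nat.card V := by
  have hex : ∀ i ∈ (terminals r)ᶜ, ∃ j, r i j := fun i hi => by
    simpa only [terminals, Set.mem_compl_iff, Set.mem_ofPred_eq, not_forall, not_not] using hi
  choose! f hf using hex
  have hf' : ∀ {i j}, r i j → f i = j := fun h => hr (hf _ fun hi => hi _ h) h
  have hedges : (SimpleGraph.fromRel r).edgeSet = (fun i => s(i, f i)) '' (terminals r)ᶜ := by
    ext e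
    induction e using Sym2.ind with | _ i j
    rw [SimpleGraph.mem_edgeSet, SimpleGraph.fromRel_adj]
    constructor
    · rintro ⟨-, h | h⟩
      · exact ⟨i, fun hi => hi j h, congrArg (s(i, ·)) (hf' h)⟩
      · exact ⟨j, fun hj => hj i h, (congrArg (s(j, ·)) (hf' h)).trans Sym2.eq_swap⟩
    · rintro ⟨k, hk, he⟩
      have hne : k ≠ f k := fun h => by
        have hkk : r k k := by simpa only [← h] using hf k hk
        exact hasymm hkk hkk
      rcases Sym2.eq_iff.1 he with ⟨rfl, rfl⟩ | ⟨rfl, rfl⟩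
      · exact ⟨hne, .inl (hf _ hk)⟩
      · exact ⟨hne.symm, .inr (hf _ hk)⟩
  have hinj : Set.InjOn (fun i => s(i, f i)) (terminals r)ᶜ := fun i hi j hj hij => by
    rcases Sym2.eq_iff.1 hij with ⟨h, -⟩ | ⟨hi', hj'⟩
    · exact h
    · exact absurd (hi' ▸ hf j hj) (hasymm (hj' ▸ hf i hi))
  rw [hedges, hinj.ncard_image, add_comm, Set.ncard_add_ncard_compl]

lemma sum_ncard_edgeSet_fromRel_add_sum_ncard_terminals [Finite V] [Fintype ι]
    {r : ι → V → V → Prop} (hr : ∀ k, RightUnique (r k))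
    (hasymm : ∀ k ⦃i j⦄, r k i j → ¬ r k j i) :
    ∑ k, (SimpleGraph.fromRel (r k)).edgeSet.ncard + ∑ k, (terminals (r k)).ncard =
      Fintype.card ι * Nat.card V := by
  rw [← Finset.sum_add_distrib, Finset.sum_congr rfl fun k _ =>
    ncard_edgeSet_fromRel_add_ncard_terminals (hr k) (hasymm k)]
  simp

end Relations

section SupportingHyperplanes

variable {F : Type*} [NormedAddCommGroup F] [InnerProductSpace ℝ F] {u v x : F} {t ρ : ℝ}

lemma forall_mem_closedBall_inner_le_iff (hρ : 0 ≤ ρ) :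
    (∀ y ∈ Metric.closedBall x ρ, ⟪u, y⟫ ≤ t) ↔ ⟪u, x⟫ + ρ * ‖u‖ ≤ t := by
  constructor
  · intro h
    have hmem : x + (ρ * ‖u‖⁻¹) • u ∈ Metric.closedBall x ρ := by
      rw [mem_closedBall_iff_norm, add_sub_cancel_left, norm_smul, norm_mul, norm_inv, norm_norm,
        Real.norm_of_nonneg hρ, mul_assoc]
      exact mul_le_of_le_one_right hρ (inv_mul_le_one)
    have hval : ⟪u, x + (ρ * ‖u‖⁻¹) • u⟫ = ⟪u, x⟫ + ρ * ‖u‖ := by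
      rw [inner_add_right, inner_smul_right, real_inner_self_eq_norm_mul_norm, mul_assoc,
        ← mul_assoc ‖u‖⁻¹, inv_mul_mul_self]
    exact hval ▸ h _ hmem
  · intro h y hy
    rw [mem_closedBall_iff_norm] at hy
    calc ⟪u, y⟫ = ⟪u, x⟫ + ⟪u, y - x⟫ := by rw [inner_sub_right]; ring
      _ ≤ ⟪u, x⟫ + ‖u‖ * ‖y - x‖ := by gcongr; exact real_inner_le_norm _ _
      _ ≤ ⟪u, x⟫ + ρ * ‖u‖ := by rw [mul_comm ρ]; gcongr
      _ ≤ t := h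

lemma forall_mem_closedBall_le_inner_iff (hρ : 0 ≤ ρ) :
    (∀ y ∈ Metric.closedBall x ρ, t ≤ ⟪u, y⟫) ↔ t ≤ ⟪u, x⟫ - ρ * ‖u‖ := by
  have h := forall_mem_closedBall_inner_le_iff (u := -u) (x := x) (t := -t) hρ
  simp only [inner_neg_left, neg_le_neg_iff, norm_neg] at h
  rw [h]
  constructor <;> intro <;> linarith

lemma disjoint_inner_eq_ball_iff (hu : u ≠ 0) :
    Disjoint {y | ⟪u, y⟫ = t} (Metric.ball x ρ) ↔ ρ * ‖u‖ ≤ |t - ⟪u, x⟫| := by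
  have hu' : 0 < ‖u‖ := norm_pos_iff.2 hu
  constructor
  · contrapose!
    intro hlt
    -- the foot of the perpendicular from `x` to the hyperplane
    refine Set.not_disjoint_iff.2 ⟨x + ((t - ⟪u, x⟫) / ‖u‖ ^ 2) • u, ?_, ?_⟩
    · rw [Set.mem_ofPred_eq, inner_add_right, inner_smul_right, real_inner_self_eq_norm_sq]
      field_simp
      ring
    · rw [mem_ball_iff_norm, add_sub_cancel_left, norm_smul, norm_div, norm_pow, norm_norm,
        Real.norm_eq_abs, div_mul_eq_mul_div, div_lt_iff₀ (by positivity), sq, ← mul_assoc]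
      exact mul_lt_mul_of_pos_right hlt hu'
  · refine fun h => Set.disjoint_left.2 fun y (hy : ⟪u, y⟫ = t) hyx => h.not_gt ?_
    rw [mem_ball_iff_norm] at hyx
    calc |t - ⟪u, x⟫| = |⟪u, y - x⟫| := by rw [inner_sub_right, hy]
      _ ≤ ‖u‖ * ‖y - x‖ := abs_real_inner_le_norm _ _
      _ < ρ * ‖u‖ := by rw [mul_comm ρ]; gcongr

lemma norm_smul_eq_of_mul_norm_le_inner (hv : ‖v‖ ≤ ρ) (h : ρ * ‖u‖ ≤ ⟪u, v⟫) :
    ‖u‖ • v = ρ • u := by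
  rcases eq_or_ne u 0 with rfl | hu
  · simp
  have hvρ : ‖v‖ = ρ := by
    refine hv.antisymm (le_of_mul_le_mul_right ?_ (norm_pos_iff.2 hu))
    exact h.trans ((real_inner_le_norm u v).trans_eq (mul_comm _ _))
  have hcauchy : ⟪u, v⟫ = ‖u‖ * ‖v‖ :=
    (real_inner_le_norm u v).antisymm (by rwa [hvρ, mul_comm])
  rw [← inner_eq_norm_mul_iff_real.1 hcauchy, hvρ]

end SupportingHyperplanes

section Packings

variable {d n : ℕ} {c : Fin n → E d} {i j k : Fin n}

lemma isPacking_iff : IsPacking c ↔ ∀ i j, i ≠ j → 2 ≤ dist (c i) (c j) := by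
  refine forall₃_congr fun i j _ => ?_
  rw [unitBall, unitBall, interior_closedBall _ one_ne_zero, interior_closedBall _ one_ne_zero,
    disjoint_ball_ball_iff one_pos one_pos, one_add_one_eq_two]

lemma contactGraph_adj_iff : (contactGraph c).Adj i j ↔ i ≠ j ∧ dist (c i) (c j) ≤ 2 := by
  refine and_congr_right fun _ => ?_
  rw [← Set.not_disjoint_iff_nonempty_inter, unitBall, unitBall,
    disjoint_closedBall_closedBall_iff zero_le_one zero_le_one, one_add_one_eq_two, not_lt]

lemma IsPacking.injective (hc : IsPacking c) : Injective c := fun i j hij => by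
  by_contra hne
  have hdist := isPacking_iff.1 hc i j hne
  rw [hij, dist_self] at hdist
  exact two_pos.not_ge hdist

lemma separatedBy_unitBall_iff {u x y : E d} {t : ℝ} :
    SeparatedBy u t (unitBall x) (unitBall y) ↔ ⟪u, x⟫ + ‖u‖ ≤ t ∧ t ≤ ⟪u, y⟫ - ‖u‖ := by
  rw [SeparatedBy, unitBall, unitBall, forall_mem_closedBall_inner_le_iff zero_le_one,
    forall_mem_closedBall_le_inner_iff zero_le_one, one_mul]

lemma disjoint_hyperplane_interior_unitBall_iff {u x : E d} {t : ℝ} (hu : u ≠ 0) :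
    Disjoint (hyperplane u t) (interior (unitBall x)) ↔ ‖u‖ ≤ |t - ⟪u, x⟫| := by
  rw [hyperplane, unitBall, interior_closedBall _ one_ne_zero, disjoint_inner_eq_ball_iff hu,
    one_mul]

lemma SeparatedBy.two_mul_norm_le_inner {u x y : E d} {t : ℝ}
    (h : SeparatedBy u t (unitBall x) (unitBall y)) : 2 * ‖u‖ ≤ ⟪u, y - x⟫ := by
  obtain ⟨hx, hy⟩ := separatedBy_unitBall_iff.1 h
  rw [inner_sub_right]
  linarith

lemma SeparatedBy.two_le_dist {u x y : E d} {t : ℝ} (hu : u ≠ 0)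
    (h : SeparatedBy u t (unitBall x) (unitBall y)) : 2 ≤ dist x y := by
  refine le_of_mul_le_mul_right ?_ (norm_pos_iff.2 hu)
  calc 2 * ‖u‖ ≤ ⟪u, y - x⟫ := h.two_mul_norm_le_inner
    _ ≤ ‖u‖ * ‖y - x‖ := real_inner_le_norm _ _
    _ = dist x y * ‖u‖ := by rw [dist_comm, dist_eq_norm, mul_comm]

lemma isTotallySeparable_of_forall_exists
    (h : ∀ i j, i ≠ j → ∃ (u : E d) (t : ℝ), u ≠ 0 ∧
      ⟪u, c i⟫ + ‖u‖ ≤ t ∧ t ≤ ⟪u, c j⟫ - ‖u‖ ∧ ∀ k, ‖u‖ ≤ |t - ⟪u, c k⟫|) :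
    IsTotallySeparable c := by
  have hsep : ∀ i j, i ≠ j → ∃ (u : E d) (t : ℝ), u ≠ 0 ∧
      SeparatedBy u t (unitBall (c i)) (unitBall (c j)) ∧
      ∀ k, Disjoint (hyperplane u t) (interior (unitBall (c k))) := fun i j hij => by
    obtain ⟨u, t, hu, hi, hj, hk⟩ := h i j hij
    exact ⟨u, t, hu, separatedBy_unitBall_iff.2 ⟨hi, hj⟩,
      fun k => (disjoint_hyperplane_interior_unitBall_iff hu).2 (hk k)⟩
  refine ⟨isPacking_iff.2 fun i j hij => ?_, hsep⟩
  obtain ⟨u, t, hu, hs, -⟩ := hsep i j hij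
  exact hs.two_le_dist hu

lemma IsTotallySeparable.inner_nonpos (hc : IsTotallySeparable c)
    (hij : (contactGraph c).Adj i j) (hik : (contactGraph c).Adj i k) (hjk : j ≠ k) :
    ⟪c j - c i, c k - c i⟫ ≤ 0 := by
  have hnorm : ∀ {l}, (contactGraph c).Adj i l → ‖c l - c i‖ ≤ 2 := fun h => by
    rw [← dist_eq_norm, dist_comm]
    exact (contactGraph_adj_iff.1 h).2
  obtain ⟨u, t, hu, hsep, hdisj⟩ := hc.2 i j hij.1
  have hu' : 0 < ‖u‖ := norm_pos_iff.2 hu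
  have hparallel : ‖u‖ • (c j - c i) = (2 : ℝ) • u :=
    norm_smul_eq_of_mul_norm_le_inner (hnorm hij) hsep.two_mul_norm_le_inner
  have htangent : t - ⟪u, c i⟫ = ‖u‖ := by
    obtain ⟨hi, hj⟩ := separatedBy_unitBall_iff.1 hsep
    have hle : ⟪u, c j - c i⟫ ≤ ‖u‖ * 2 :=
      (real_inner_le_norm _ _).trans (by gcongr; exact hnorm hij)
    rw [inner_sub_right] at hle
    linarith
  have hsides : ⟪u, c k - c i⟫ ≤ 0 ∨ 2 * ‖u‖ ≤ ⟪u, c k - c i⟫ := by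
    rw [inner_sub_right]
    rcases le_abs.1 ((disjoint_hyperplane_interior_unitBall_iff hu).1 (hdisj k)) with h | h
    · exact .inl (by linarith)
    · exact .inr (by linarith)
  rcases hsides with hneg | hfar
  · refine nonpos_of_mul_nonpos_right ?_ hu'
    calc ‖u‖ * ⟪c j - c i, c k - c i⟫ = 2 * ⟪u, c k - c i⟫ := by
          rw [← real_inner_smul_left, hparallel, real_inner_smul_left]
      _ ≤ 0 := by linarith
  · -- Only the `j`-th ball touches the `i`-th one from beyond their common tangent.
    have hsmul : ‖u‖ • (c k - c i) = ‖u‖ • (c j - c i) :=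
      (norm_smul_eq_of_mul_norm_le_inner (hnorm hik) hfar).trans hparallel.symm
    exact absurd (hc.1.injective (sub_left_injective (smul_right_injective _ hu'.ne' hsmul)))
      hjk.symm

end Packings

section DirectedContacts

variable {d n : ℕ}

/-- Ball `i` touches ball `j`, which lies from it in a direction belonging to `Q`. -/
def ContactTowards (c : Fin n → E d) (Q : Set (E d)) (i j : Fin n) : Prop :=
  (contactGraph c).Adj i j ∧ c j - c i ∈ Q

lemma IsTotallySeparable.biUnique_contactTowards {c : Fin n → E d} (hc : IsTotallySeparable c)
    {Q : Set (E d)} (hQ : ∀ x ∈ Q, ∀ y ∈ Q, 0 < ⟪x, y⟫) : BiUnique (ContactTowards c Q) := by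
  constructor
  · intro i j k hik hjk
    by_contra hne
    have hle := hc.inner_nonpos hik.1.symm hjk.1.symm hne
    rw [← neg_sub, ← neg_sub (c k), inner_neg_neg] at hle
    exact hle.not_gt (hQ _ hik.2 _ hjk.2)
  · intro i j k hij hik
    by_contra hne
    exact (hc.inner_nonpos hij.1 hik.1 hne).not_gt (hQ _ hij.2 _ hik.2)

lemma isStrictOrder_sub_mem {ι M : Type*} [AddGroup M] {Q : AddSubsemigroup M} (hQ : 0 ∉ Q)
    (c : ι → M) : IsStrictOrder ι fun i j => c j - c i ∈ Q where
  irrefl i := by rwa [sub_self]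
  trans i j k hij hjk := by simpa only [sub_add_sub_cancel] using Q.add_mem hjk hij

/-- Half-open quadrants of the plane: together with their negatives, the two of them partition the
nonzero vectors. -/
def quadrant (k : Fin 2) : AddSubsemigroup (E 2) where
  carrier := ![{v | 0 < v 0 ∧ 0 ≤ v 1}, {v | v 0 ≤ 0 ∧ 0 < v 1}] k
  add_mem' := by
    fin_cases k
    · exact fun hx hy => ⟨add_pos hx.1 hy.1, add_nonneg hx.2 hy.2⟩
    · exact fun hx hy => ⟨add_nonpos hx.1 hy.1, add_pos hx.2 hy.2⟩

lemma mem_quadrant_zero {v : E 2} : v ∈ quadrant 0 ↔ 0 < v 0 ∧ 0 ≤ v 1 := Iff.rfl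

lemma mem_quadrant_one {v : E 2} : v ∈ quadrant 1 ↔ v 0 ≤ 0 ∧ 0 < v 1 := Iff.rfl

lemma inner_pos_of_mem_quadrant {k : Fin 2} {x y : E 2} (hx : x ∈ quadrant k)
    (hy : y ∈ quadrant k) : 0 < ⟪x, y⟫ := by
  rw [PiLp.inner_apply, Fin.sum_univ_two]
  fin_cases k
  · exact add_pos_of_pos_of_nonneg (mul_pos hy.1 hx.1) (mul_nonneg hy.2 hx.2)
  · exact add_pos_of_nonneg_of_pos (mul_nonneg_of_nonpos_of_nonpos hy.1 hx.1) (mul_pos hy.2 hx.2)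

lemma zero_notMem_quadrant (k : Fin 2) : (0 : E 2) ∉ quadrant k := fun h =>
  (inner_pos_of_mem_quadrant h h).ne' (inner_zero_left _)

lemma exists_mem_quadrant_or_neg_mem {v : E 2} (hv : v ≠ 0) :
    ∃ k, v ∈ quadrant k ∨ -v ∈ quadrant k := by
  by_contra! h
  have h0 := h 0
  have h1 := h 1
  simp only [mem_quadrant_zero, mem_quadrant_one, PiLp.neg_apply] at h0 h1
  apply hv
  ext l
  fin_cases l <;> simp <;> grind

lemma exists_notMem_quadrant_and_neg_notMem (v : E 2) :
    ∃ k, v ∉ quadrant k ∧ -v ∉ quadrant k := by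
  by_contra! h
  have h0 := h 0
  have h1 := h 1
  simp only [mem_quadrant_zero, mem_quadrant_one, PiLp.neg_apply] at h0 h1
  grind

lemma IsPacking.contactGraph_le_iSup_fromRel {c : Fin n → E 2} (hc : IsPacking c) :
    contactGraph c ≤ ⨆ k, SimpleGraph.fromRel (ContactTowards c (quadrant k)) := by
  intro i j hij
  obtain ⟨k, hk⟩ := exists_mem_quadrant_or_neg_mem (sub_ne_zero.2 (hc.injective.ne hij.1.symm))
  rw [neg_sub] at hk
  exact SimpleGraph.iSup_adj.2 ⟨k, hij.1, hk.imp (⟨hij, ·⟩) (⟨hij.symm, ·⟩)⟩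

lemma two_mul_sqrt_le_add_of_le_mul {n p q : ℕ} (h : n ≤ p * q) : 2 * √(n : ℝ) ≤ p + q := by
  have h' : (n : ℝ) ≤ p * q := by exact_mod_cast h
  have hsqrt : √(n : ℝ) ≤ (p + q) / 2 :=
    Real.sqrt_le_iff.2 ⟨by positivity, by linarith [four_mul_le_sq_add (p : ℝ) q]⟩
  linarith

theorem IsTotallySeparable.contactNumber_le {c : Fin n → E 2} (hc : IsTotallySeparable c) :
    (contactNumber c : ℝ) ≤ 2 * n - 2 * √n := by
  let r : Fin 2 → Fin n → Fin n → Prop := fun k => ContactTowards c (quadrant k)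
  let s : Fin 2 → Fin n → Fin n → Prop := fun k i j => c j - c i ∈ quadrant k
  have hs : ∀ k, IsStrictOrder (Fin n) (s k) := fun k =>
    isStrictOrder_sub_mem (zero_notMem_quadrant k) c
  have hrs : ∀ k, r k ≤ s k := fun _ _ _ h => h.2
  have hr : ∀ k, BiUnique (r k) := fun k =>
    hc.biUnique_contactTowards fun _ hx _ hy => inner_pos_of_mem_quadrant hx hy
  have hpaths : n ≤ (terminals (r 0)).ncard * (terminals (r 1)).ncard := by
    have hincomp : ∀ i j, ∃ k, ¬ SymmGen (s k) i j := fun i j => by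
      obtain ⟨k, hk, hk'⟩ := exists_notMem_quadrant_and_neg_notMem (c j - c i)
      rw [neg_sub] at hk'
      exact ⟨k, not_or.2 ⟨hk, hk'⟩⟩
    simpa using card_le_prod_ncard_terminals (fun k => (hr k).1) hrs hincomp
  have hcontacts : contactNumber c ≤ ∑ k, (SimpleGraph.fromRel (r k)).edgeSet.ncard := calc
    contactNumber c ≤ (⋃ k, (SimpleGraph.fromRel (r k)).edgeSet).ncard := by
      rw [← SimpleGraph.edgeSet_iSup]
      exact Set.ncard_le_ncard (SimpleGraph.edgeSet_mono hc.1.contactGraph_le_iSup_fromRel)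
    _ ≤ _ := Set.ncard_iUnion_le_of_fintype _
  have hcount := sum_ncard_edgeSet_fromRel_add_sum_ncard_terminals (fun k => (hr k).2)
    fun k i j hij hji => asymm (hrs k i j hij) (hrs k j i hji)
  rw [Fin.sum_univ_two (fun k => (terminals (r k)).ncard), Fintype.card_fin, Nat.card_fin] at hcount
  have hedges : (contactNumber c : ℝ) + ((terminals (r 0)).ncard + (terminals (r 1)).ncard) ≤
      2 * n := by
    exact_mod_cast hcount ▸ Nat.add_le_add_right hcontacts _
  linarith [two_mul_sqrt_le_add_of_le_mul hpaths]

end DirectedContacts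

section LatticePackings

variable {d n : ℕ}

/-- The point `2z` of the lattice `2ℤᵈ`, in which neighbouring unit balls touch. -/
noncomputable def latticePoint (z : Fin d → ℤ) : E d := WithLp.toLp 2 fun k => 2 * (z k : ℝ)

lemma inner_single_latticePoint (k : Fin d) (a : ℝ) (z : Fin d → ℤ) :
    ⟪EuclideanSpace.single k a, latticePoint z⟫ = a * (2 * z k) := by
  simp [latticePoint, EuclideanSpace.inner_single_left]

lemma dist_latticePoint_add_single (z : Fin d → ℤ) (k : Fin d) :
    dist (latticePoint z) (latticePoint (z + Pi.single k 1)) = 2 := by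
  have hsub : latticePoint (z + Pi.single k 1) - latticePoint z = EuclideanSpace.single k 2 := by
    ext l
    by_cases hl : l = k
    · subst hl
      simp [latticePoint, mul_add]
    · simp [latticePoint, hl]
  rw [dist_comm, dist_eq_norm, hsub, PiLp.norm_single, Real.norm_two]

lemma isTotallySeparable_latticePoint {z : Fin n → Fin d → ℤ} (hz : Injective z) :
    IsTotallySeparable (latticePoint ∘ z) := by
  refine isTotallySeparable_of_forall_exists fun i j hij => ?_
  obtain ⟨k, hk⟩ := ne_iff.1 (hz.ne hij)
  obtain ⟨a, ha, hlt⟩ : ∃ a : ℤ, |a| = 1 ∧ a * z i k < a * z j k := by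
    rcases hk.lt_or_gt with h | h
    · exact ⟨1, by simp, by linarith⟩
    · exact ⟨-1, by simp, by linarith⟩
  have hnorm : ‖EuclideanSpace.single k (a : ℝ)‖ = 1 := by
    rw [PiLp.norm_single, Real.norm_eq_abs]
    exact_mod_cast ha
  have hlt' : (a : ℝ) * z i k + 1 ≤ a * z j k := by exact_mod_cast hlt
  refine ⟨EuclideanSpace.single k (a : ℝ), 2 * (a * z i k) + 1, ?_, ?_, ?_, fun l => ?_⟩
  · exact norm_ne_zero_iff.1 (hnorm ▸ one_ne_zero)
  · rw [hnorm, comp_apply, inner_single_latticePoint]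
    linarith
  · rw [hnorm, comp_apply, inner_single_latticePoint]
    linarith
  · have hodd : (1 : ℤ) ≤ |2 * (a * z i k) + 1 - a * (2 * z l k)| :=
      Int.one_le_abs (by lia)
    rw [hnorm, comp_apply, inner_single_latticePoint]
    exact_mod_cast hodd

/-- The cell `z j` follows the cell `z i` in the direction of the `k`-th axis. -/
def UnitStep (z : Fin n → Fin d → ℤ) (k : Fin d) (i j : Fin n) : Prop := z j = z i + Pi.single k 1

lemma UnitStep.lt {z : Fin n → Fin d → ℤ} {k : Fin d} {i j : Fin n} (h : UnitStep z k i j) :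
    z i < z j := by
  have single_pos : (0 : Fin d → ℤ) < Pi.single k 1 := Pi.single_pos.2 Int.one_pos
  exact (lt_add_of_pos_right (z i) single_pos).trans_eq h.symm

lemma UnitStep.not_symm {z : Fin n → Fin d → ℤ} {k l : Fin d} {i j : Fin n}
    (h : UnitStep z k i j) : ¬ UnitStep z l j i := fun h' => h.lt.asymm h'.lt

lemma UnitStep.direction_unique {z : Fin n → Fin d → ℤ} {k l : Fin d} {i j : Fin n}
    (hk : UnitStep z k i j) (hl : UnitStep z l i j) : k = l := by
  have h := congrFun (add_left_cancel (hk.symm.trans hl)) k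
  by_contra hne
  simp [hne] at h

lemma rightUnique_unitStep {z : Fin n → Fin d → ℤ} (hz : Injective z) (k : Fin d) :
    RightUnique (UnitStep z k) := fun _ _ _ h h' => hz (h.trans h'.symm)

lemma iSup_fromRel_unitStep_le (z : Fin n → Fin d → ℤ) :
    ⨆ k, SimpleGraph.fromRel (UnitStep z k) ≤ contactGraph (latticePoint ∘ z) := by
  have hadj : ∀ {k i j}, UnitStep z k i j → (contactGraph (latticePoint ∘ z)).Adj i j := by
    intro k i j h
    refine contactGraph_adj_iff.2 ⟨ne_of_apply_ne z h.lt.ne, ?_⟩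
    rw [comp_apply, comp_apply, h, dist_latticePoint_add_single]
  exact iSup_le fun k i j h => h.2.elim hadj fun h' => (hadj h').symm

lemma pairwise_disjoint_fromRel_unitStep (z : Fin n → Fin d → ℤ) :
    Pairwise (Disjoint on fun k => SimpleGraph.fromRel (UnitStep z k)) := by
  refine fun k l hkl => SimpleGraph.disjoint_left.2 fun i j h h' => hkl ?_
  rcases h.2 with h | h <;> rcases h'.2 with h' | h'
  · exact h.direction_unique h'
  · exact absurd h' h.not_symm
  · exact absurd h' h.not_symm
  · exact h.direction_unique h'

lemma mul_le_contactNumber_latticePoint_add {z : Fin n → Fin d → ℤ} (hz : Injective z) :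
    d * n ≤ contactNumber (latticePoint ∘ z) + ∑ k, (terminals (UnitStep z k)).ncard := by
  have hcount := sum_ncard_edgeSet_fromRel_add_sum_ncard_terminals (rightUnique_unitStep hz)
    fun k _ _ h => h.not_symm
  rw [Fintype.card_fin, Nat.card_fin] at hcount
  rw [← hcount, add_le_add_iff_right]
  calc ∑ k, (SimpleGraph.fromRel (UnitStep z k)).edgeSet.ncard
      = (⋃ k, (SimpleGraph.fromRel (UnitStep z k)).edgeSet).ncard := by
        rw [Set.ncard_iUnion_of_finite (fun _ => Set.toFinite _), finsum_eq_sum_of_fintype]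
        exact fun k l hkl =>
          SimpleGraph.disjoint_edgeSet.2 (pairwise_disjoint_fromRel_unitStep z hkl)
    _ ≤ contactNumber (latticePoint ∘ z) := by
        rw [← SimpleGraph.edgeSet_iSup]
        exact Set.ncard_le_ncard (SimpleGraph.edgeSet_mono (iSup_fromRel_unitStep_le z))

end LatticePackings

section Grid

variable {n a b : ℕ}

/-- Column and row of the `i`-th of `n` cells filling a grid with `a` columns row by row. -/
def grid (n a : ℕ) (i : Fin n) : Fin 2 → ℤ := ![((i : ℕ) % a : ℕ), ((i : ℕ) / a : ℕ)]

lemma grid_injective (n a : ℕ) : Injective (grid n a) := fun i j h => by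
  have hmod : (i : ℕ) % a = j % a := Int.ofNat_inj.1 (congrFun h 0)
  have hdiv : (i : ℕ) / a = j / a := Int.ofNat_inj.1 (congrFun h 1)
  rw [Fin.ext_iff, ← Nat.div_add_mod i a, hmod, hdiv, Nat.div_add_mod]

lemma unitStep_grid_zero {i j : Fin n} (hij : (j : ℕ) = i + 1) (hdiv : (j : ℕ) / a = i / a) :
    UnitStep (grid n a) 0 i j := by
  have hmod : (j : ℕ) % a = i % a + 1 := by
    have hi := Nat.div_add_mod i a
    have hj := Nat.div_add_mod j a
    rw [hdiv] at hj
    lia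
  ext l
  fin_cases l
  · simp [grid, hmod, -Int.natCast_emod]
  · simp [grid, hdiv, -Int.natCast_ediv]

lemma unitStep_grid_one (ha : 0 < a) {i j : Fin n} (hij : (j : ℕ) = i + a) :
    UnitStep (grid n a) 1 i j := by
  ext l
  fin_cases l
  · simp [grid, hij]
  · simp [grid, hij, Nat.add_div_right _ ha, -Int.natCast_ediv]

/-- Each of the `b` rows has only one last cell. -/
lemma ncard_terminals_unitStep_grid_zero_le (h : n ≤ a * b) :
    (terminals (UnitStep (grid n a) 0)).ncard ≤ b := by
  have hrow : ∀ i : Fin n, (i : ℕ) / a ∈ Set.Iio b := fun i =>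
    Nat.div_lt_of_lt_mul (i.2.trans_le h)
  have hinj : Set.InjOn (fun i : Fin n => (i : ℕ) / a) (terminals (UnitStep (grid n a) 0)) := by
    intro i hi j hj (hij : (i : ℕ) / a = j / a)
    by_contra hne
    wlog hlt : i < j generalizing i j
    · exact this hj hi hij.symm (Ne.symm hne) (lt_of_le_of_ne (not_lt.1 hlt) (Ne.symm hne))
    have hsucc : (i + 1 : ℕ) / a = i / a :=
      (hij ▸ Nat.div_le_div_right hlt).antisymm (Nat.div_le_div_right (Nat.le_succ _))
    exact hi ⟨i + 1, by lia⟩ (unitStep_grid_zero rfl hsucc)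
  simpa using Set.ncard_le_ncard_of_injOn _ (fun i _ => hrow i) hinj (Set.finite_Iio b)

lemma ncard_terminals_unitStep_grid_one_le (ha : 0 < a) :
    (terminals (UnitStep (grid n a) 1)).ncard ≤ a := by
  have hcolumn : ∀ i : Fin n, (i : ℕ) % a ∈ Set.Iio a := fun i => Nat.mod_lt _ ha
  have hinj : Set.InjOn (fun i : Fin n => (i : ℕ) % a) (terminals (UnitStep (grid n a) 1)) := by
    intro i hi j hj (hij : (i : ℕ) ≡ j [MOD a])
    by_contra hne
    wlog hlt : i < j generalizing i j
    · exact this hj hi hij.symm (Ne.symm hne) (lt_of_le_of_ne (not_lt.1 hlt) (Ne.symm hne))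
    have hadd : (i + a : ℕ) ≤ j := hij.add_le_of_lt hlt
    exact hi ⟨i + a, by lia⟩ (unitStep_grid_one ha rfl)
  simpa using Set.ncard_le_ncard_of_injOn _ (fun i _ => hcolumn i) hinj (Set.finite_Iio a)

lemma two_mul_le_contactNumber_grid_add (ha : 0 < a) (h : n ≤ a * b) :
    2 * n ≤ contactNumber (latticePoint ∘ grid n a) + (a + b) := by
  have hcount := mul_le_contactNumber_latticePoint_add (grid_injective n a)
  rw [Fin.sum_univ_two] at hcount
  linarith [ncard_terminals_unitStep_grid_zero_le h,
    ncard_terminals_unitStep_grid_one_le (n := n) ha]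

lemma le_half_mul_sub_half {n k : ℕ} (h : 4 * n ≤ k ^ 2) : n ≤ k / 2 * (k - k / 2) := by
  obtain ⟨l, rfl | rfl⟩ := Nat.even_or_odd' k
  · rw [show 2 * l / 2 = l by lia, show 2 * l - l = l by lia]
    linarith
  · rw [show (2 * l + 1) / 2 = l by lia, show 2 * l + 1 - l = l + 1 by lia]
    suffices 4 * n ≤ 4 * (l * (l + 1)) + 1 by lia
    linarith

lemma exists_isTotallySeparable_lt_contactNumber (hn : 0 < n) :
    ∃ c : Fin n → E 2, IsTotallySeparable c ∧ 2 * (n : ℝ) - 2 * √n < contactNumber c + 1 := by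
  set k := ⌈2 * √(n : ℝ)⌉₊
  have hk : 2 * √(n : ℝ) ≤ k := Nat.le_ceil _
  have hk' : (k : ℝ) < 2 * √n + 1 := Nat.ceil_lt_add_one (by positivity)
  have hsq : (4 : ℝ) * n ≤ k ^ 2 := calc
    (4 : ℝ) * n = (2 * √n) ^ 2 := by rw [mul_pow, Real.sq_sqrt (by positivity)]; norm_num
    _ ≤ k ^ 2 := by gcongr
  have hfit : n ≤ k / 2 * (k - k / 2) := le_half_mul_sub_half (by exact_mod_cast hsq)
  have hhalf : 0 < k / 2 := Nat.pos_of_mul_pos_right (hn.trans_le hfit)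
  have hcount := two_mul_le_contactNumber_grid_add hhalf hfit
  rw [Nat.add_sub_cancel' (Nat.div_le_self k 2)] at hcount
  have hcount' : (2 : ℝ) * n ≤ contactNumber (latticePoint ∘ grid n (k / 2)) + k := by
    exact_mod_cast hcount
  exact ⟨_, isTotallySeparable_latticePoint (grid_injective n (k / 2)), by linarith⟩

end Grid

end SeparablePacking

/-- For all `n > 1` the maximum contact number of totally separable packings of `n` unit disks
in the plane is attained and equals `⌊2n - 2√n⌋`. -/
theorem mainTheorem4 (n : ℕ) (hn : 1 < n) :
    IsGreatest (SeparablePacking.contactNumbers n 2) (SeparablePacking.maxContactNumber n 2) ∧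
      (SeparablePacking.maxContactNumber n 2 : ℤ) = ⌊2 * (n : ℝ) - 2 * √(n : ℝ)⌋ := by
  have hgreatest :
      IsGreatest (SeparablePacking.contactNumbers n 2) ⌊2 * (n : ℝ) - 2 * √(n : ℝ)⌋₊ := by
    obtain ⟨c, hc, hlt⟩ :=
      SeparablePacking.exists_isTotallySeparable_lt_contactNumber (zero_lt_one.trans hn)
    refine ⟨⟨c, hc, (Nat.le_floor hc.contactNumber_le).antisymm ?_⟩, ?_⟩
    · exact Nat.lt_succ_iff.1 ((Nat.floor_lt' (Nat.succ_ne_zero _)).2 (by exact_mod_cast hlt))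
    · rintro m ⟨c', hc', rfl⟩
      exact Nat.le_floor hc'.contactNumber_le
  have hnonneg : 0 ≤ 2 * (n : ℝ) - 2 * √(n : ℝ) := by
    have hsqrt : √(n : ℝ) ≤ n := Real.sqrt_le_self_iff.2 (.inr (by exact_mod_cast hn.le))
    linarith
  rw [SeparablePacking.maxContactNumber, hgreatest.csSup_eq, Int.natCast_floor_eq_floor hnonneg]
  exact ⟨hgreatest, rfl⟩
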